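/- There are universal constants $C>0$ and $\mu_0>1$ with the following property. Write $\|\cdot\|$ for the Euclidean norm on $\mathbb C^2$ and for the induced operator norm on $\mathrm M(2,\mathbb C)$, and for $A\neq 0$ put $\sigma_1(A)=\|A\|$ and $\sigma_2(A)=|\det A|/\|A\|$. Let $B:\mathbb Z\to \mathrm M(2,\mathbb C)$, let $0<c<M$ with $c<\|B(j)\|<M$ for all $j\in\mathbb Z$, and let $\mu\ge\mu_0$ be such that for every $j\in\mathbb Z$ one has $B(j+1)B(j)\ne 0$ and $$\frac{\sigma_2(B(j))}{\sigma_1(B(j))}\le \mu^{-1},\qquad \frac{\sigma_1(B(j+1))\,\sigma_1(B(j))}{\sigma_1(B(j+1)B(j))}\le \mu^{1/4}.$$ Put $B_n(j)=B(j+n-1)\cdots B(j)$ for $n\ge 1$. Then: (1) $B$ has dominated splitting, that is, for each $j\in\mathbb Z$ there are one-dimensional subspaces $E^u(j),E^s(j)$ of $\mathbb C^2$ such that (a) $B(j)E^u(j)\subseteq E^u(j+1)$ and $B(j)E^s(j)\subseteq E^s(j+1)$ for all $j$; (b) there are an integer $N\ge 1$ and $\lambda>1$ with $\|B_N(j)\vec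 u\|>\lambda\|B_N(j)\vec s\|$ for all $j$ and all unit vectors $\vec u\in E^u(j)$, $\vec s\in E^s(j)$; (c) $\inf_{j} d(E^u(j),E^s(j))>0$, where $d$ is the distance of lines in $\mathbb C^2$ given by identifying the line spanned by $(z_1,z_2)$ with the point $z_2/z_1$ of $\mathbb{CP}^1=\mathbb C\cup\{\infty\}$ and using the chordal metric $d(z,w)=\frac{2|z-w|}{\sqrt{(1+|z|^2)(1+|w|^2)}}$, $d(z,\infty)=\frac{2}{\sqrt{1+|z|^2}}$ on $\mathbb{CP}^1$; (d) $\inf_{j}\|B_N(j)\|>0$ for the same $N$ as in (b). (2) For all $j\in\mathbb Z$ and all $n\ge 3$, $B_n(j)\neq 0$ and $$\left|\log\|B_n(j)\|+\sum_{k=1}^{n-2}\log\|B(j+k)\|-\sum_{k=0}^{n-2}\log\|B(j+k+1)B(j+k)\|\right|\le C\,n\,\mu^{-1/2}.$$ -/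

import Mathlib

/- The norm on matrices is the operator norm induced by the Euclidean norm on `ℂ²`. -/
open scoped Matrix.Norms.L2Operator

noncomputable section

namespace DomSplit

/-- The algebra `M(2, ℂ)`. -/
abbrev Mat2 : Type := Matrix (Fin 2) (Fin 2) ℂ

/-- `ℂ²` with the Euclidean norm. -/
abbrev Vec2 : Type := EuclideanSpace ℂ (Fin 2)

/-- The action of a matrix on a vector of `ℂ²`. -/
def act (A : Mat2) (v : Vec2) : Vec2 := Matrix.toEuclideanLin A v

/-- The largest singular value, `σ₁(A) = ‖A‖`. -/
def sigma1 (A : Mat2) : ℝ := ‖A‖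

/-- The smallest singular value of a nonzero matrix, `σ₂(A) = |det A| / ‖A‖`. -/
def sigma2 (A : Mat2) : ℝ := ‖A.det‖ / ‖A‖

/-- `B_n(j) = B(j + n - 1) ⋯ B(j)`, with `B_0(j)` the identity. -/
def iter (B : ℤ → Mat2) : ℕ → ℤ → Mat2
  | 0, _ => 1
  | n + 1, j => B (j + n) * iter B n j

/-- The projection `(z₁, z₂) ↦ z₂ / z₁` of nonzero vectors to `ℂℙ¹ = ℂ ∪ {∞}`. -/
def proj (v : Vec2) : OnePoint ℂ :=
  open Classical in if v 0 = 0 then OnePoint.infty else OnePoint.some (v 1 / v 0)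

/-- The chordal metric on `ℂℙ¹ = ℂ ∪ {∞}`. -/
def chordalDist : OnePoint ℂ → OnePoint ℂ → ℝ
  | none, none => 0
  | some z, none => 2 / √(1 + ‖z‖ ^ 2)
  | none, some w => 2 / √(1 + ‖w‖ ^ 2)
  | some z, some w => 2 * ‖z - w‖ / √((1 + ‖z‖ ^ 2) * (1 + ‖w‖ ^ 2))

/-- Dominated splitting of a sequence `B : ℤ → M(2, ℂ)`. The distance of two lines is the chordal
distance of the points of `ℂℙ¹` that their unit vectors represent. -/
def HasDominatedSplitting (B : ℤ → Mat2) : Prop :=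
  ∃ Eu Es : ℤ → Submodule ℂ Vec2,
    (∀ j, Module.finrank ℂ (Eu j) = 1) ∧
    (∀ j, Module.finrank ℂ (Es j) = 1) ∧
    (∀ j, ∀ v ∈ Eu j, act (B j) v ∈ Eu (j + 1)) ∧
    (∀ j, ∀ v ∈ Es j, act (B j) v ∈ Es (j + 1)) ∧
    (∃ N : ℕ, 1 ≤ N ∧
      (∃ lam : ℝ, 1 < lam ∧ ∀ j, ∀ u ∈ Eu j, ∀ s ∈ Es j, ‖u‖ = 1 → ‖s‖ = 1 →
        lam * ‖act (iter B N j) s‖ < ‖act (iter B N j) u‖) ∧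
      (∃ δ : ℝ, 0 < δ ∧ ∀ j, δ ≤ ‖iter B N j‖)) ∧
    (∃ δ : ℝ, 0 < δ ∧ ∀ j, ∀ u ∈ Eu j, ∀ s ∈ Es j, ‖u‖ = 1 → ‖s‖ = 1 →
      δ ≤ chordalDist (proj u) (proj s))

end DomSplit

end

noncomputable section

namespace DomSplit

/-! Put `t = μ ^ (1/4)`. If `Y` has rank one, then `‖ZYX‖ ‖Y‖ = ‖ZY‖ ‖YX‖` exactly; for general `Y`
the error is at most `3 |det Y| ‖Z‖ ‖X‖` (`abs_norm_triple_sub_le`). When the factors of `ZY` and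
`YX` are aligned up to `2t` and `|det Y| ≤ t⁻⁴ ‖Y‖²`, the relative error is `12 / t²`, of order `μ ^
(-1/2)`. Alignment up to `2t` propagates to all products by induction (`norm_mul_iter_le`,
`norm_iter_mul_le`), so (2) follows by summing logarithms of the triple estimate along the orbit.

For (1), the products of past and of future factors, scaled to norm one, become singular in the
limit. `E^u(j)` is the range of the limit `U j` of the past, `E^s(j)` the kernel of the limit `S j`
of the future. Alignment of past with future gives `‖S j * U j‖ ≥ 1 / (4t)`, which separates the two
lines; with the smallness of `det (B j)` this gives domination already for `N = 1`. -/

theorem act_mul (A D : Mat2) (v : Vec2) : act (A * D) v = act A (act D v) := by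
  simp [act, Matrix.toLpLin_apply]

theorem act_sub (A D : Mat2) (v : Vec2) : act (A - D) v = act A v - act D v := by
  simp [act]

theorem act_smul (A : Mat2) (z : ℂ) (v : Vec2) : act A (z • v) = z • act A v := by
  simp [act]

theorem act_add (A : Mat2) (v w : Vec2) : act A (v + w) = act A v + act A w := by
  simp [act]

theorem act_apply_zero (A : Mat2) (v : Vec2) : act A v 0 = A 0 0 * v 0 + A 0 1 * v 1 := by
  simp [act, Matrix.toLpLin_apply]

theorem act_apply_one (A : Mat2) (v : Vec2) : act A v 1 = A 1 0 * v 0 + A 1 1 * v 1 := by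
  simp [act, Matrix.toLpLin_apply]

theorem norm_act_le (A : Mat2) (v : Vec2) : ‖act A v‖ ≤ ‖A‖ * ‖v‖ :=
  Matrix.l2_opNorm_mulVec A v

theorem norm_le_of_act_le {A : Mat2} {K : ℝ} (hK : 0 ≤ K) (h : ∀ v, ‖act A v‖ ≤ K * ‖v‖) :
    ‖A‖ ≤ K :=
  ContinuousLinearMap.opNorm_le_bound _ hK h

/-- The operator norm is attained on the unit sphere. -/
theorem exists_norm_act_eq (A : Mat2) : ∃ v : Vec2, ‖v‖ = 1 ∧ ‖act A v‖ = ‖A‖ := by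
  have hc : Continuous (act A) := LinearMap.continuous_of_finiteDimensional _
  obtain ⟨v, hv, hmax⟩ := (isCompact_sphere (0 : Vec2) 1).exists_isMaxOn
    (NormedSpace.sphere_nonempty.mpr zero_le_one) hc.norm.continuousOn
  have hv1 : ‖v‖ = 1 := by simpa using hv
  refine ⟨v, hv1, le_antisymm (by simpa [hv1] using norm_act_le A v) ?_⟩
  refine norm_le_of_act_le (norm_nonneg _) fun w => ?_
  rcases eq_or_ne w 0 with rfl | hw
  · simp [act]
  have hw' : 0 < ‖w‖ := norm_pos_iff.mpr hw
  have h := hmax (show ((‖w‖⁻¹ : ℝ) : ℂ) • w ∈ Metric.sphere (0 : Vec2) 1 by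
    simp [norm_smul, hw'.ne'])
  simp only [Set.mem_ofPred_eq, act_smul, norm_smul, Complex.norm_real, norm_inv, norm_norm] at h
  rwa [inv_mul_le_iff₀ hw', mul_comm] at h

/-! ### Wedge product and orthogonal decomposition in `ℂ²`. -/

/-- The determinant of the matrix with columns `x` and `y`. -/
def wedge (x y : Vec2) : ℂ := x 0 * y 1 - x 1 * y 0

theorem wedge_act (A : Mat2) (x y : Vec2) : wedge (act A x) (act A y) = A.det * wedge x y := by
  simp only [wedge, act_apply_zero, act_apply_one, Matrix.det_fin_two]
  ring

theorem wedge_smul_left (z : ℂ) (x y : Vec2) : wedge (z • x) y = z * wedge x y := by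
  simp [wedge]; ring

/-- The vector orthogonal to `x` obtained by a quarter turn and conjugation. -/
def perp (x : Vec2) : Vec2 := !₂[-star (x 1), star (x 0)]

theorem norm_sq_eq_sum (x : Vec2) : ‖x‖ ^ 2 = ‖x 0‖ ^ 2 + ‖x 1‖ ^ 2 := by
  simp [EuclideanSpace.norm_sq_eq, Fin.sum_univ_two]

theorem norm_perp (x : Vec2) : ‖perp x‖ = ‖x‖ := by
  refine (sq_eq_sq₀ (norm_nonneg _) (norm_nonneg _)).mp ?_
  simp [norm_sq_eq_sum, perp, add_comm]

theorem norm_sq_smul_eq (x y : Vec2) :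
    ((‖x‖ ^ 2 : ℝ) : ℂ) • y = inner ℂ x y • x + wedge x y • perp x := by
  have h0 : ((‖x‖ ^ 2 : ℝ) : ℂ) = star (x 0) * x 0 + star (x 1) * x 1 := by
    rw [norm_sq_eq_sum]
    push_cast
    rw [← Complex.conj_mul', ← Complex.conj_mul']
    rfl
  have h1 : inner ℂ x y = star (x 0) * y 0 + star (x 1) * y 1 := by
    simp [PiLp.inner_apply, Fin.sum_univ_two, mul_comm]
  rw [h0, h1]
  ext i
  fin_cases i <;> simp [wedge, perp] <;> ring

theorem norm_wedge_le (x y : Vec2) : ‖wedge x y‖ ≤ ‖x‖ * ‖y‖ := by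
  have h : wedge x y = -inner ℂ (perp y) x * (1 : ℂ) := by
    simp [PiLp.inner_apply, Fin.sum_univ_two, perp, wedge]
    ring
  rw [h, mul_one, norm_neg, mul_comm, ← norm_perp y]
  exact norm_inner_le_norm _ _

/-! ### Rank-one approximation and triple products. -/

/-- Approximation of a nonzero matrix by one of rank one and the same norm. -/
theorem exists_rank_one_approx {Y : Mat2} (hY : Y ≠ 0) :
    ∃ (Y₀ : Mat2) (u : Vec2), ‖Y₀‖ = ‖Y‖ ∧ ‖Y - Y₀‖ ≤ ‖Y.det‖ / ‖Y‖ ∧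
      ∀ x, ∃ z : ℂ, act Y₀ x = z • u := by
  have hpos : 0 < ‖Y‖ := norm_pos_iff.mpr hY
  obtain ⟨v, hv, hYv⟩ := exists_norm_act_eq Y
  set u : Vec2 := ((‖Y‖⁻¹ : ℝ) : ℂ) • act Y v with hu
  have hu1 : ‖u‖ = 1 := by simp [hu, norm_smul, hYv, hpos.ne']
  -- `P` is the orthogonal projection onto the image of a maximizing vector `v`, so `P * Y` keeps
  -- the norm. The remainder is controlled by `u ∧ Yx = ‖Y‖⁻¹ det Y (v ∧ x)`.
  let P : Mat2 := Matrix.vecMulVec u.ofLp (star u.ofLp)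
  have hP : ∀ x, act P x = inner ℂ u x • u := by
    intro x
    ext i
    fin_cases i <;>
      simp [P, act_apply_zero, act_apply_one, Matrix.vecMulVec_apply, PiLp.inner_apply,
        Fin.sum_univ_two] <;> ring
  have hsub : ∀ x, act (Y - P * Y) x = wedge u (act Y x) • perp u := by
    intro x
    have h := norm_sq_smul_eq u (act Y x)
    rw [hu1] at h
    rw [act_sub, act_mul, hP, sub_eq_iff_eq_add']
    simpa using h
  refine ⟨P * Y, u, le_antisymm ?_ ?_, ?_, fun x => ⟨_, by rw [act_mul, hP]⟩⟩
  · refine norm_le_of_act_le hpos.le fun x => ?_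
    rw [act_mul, hP, norm_smul, hu1, mul_one]
    calc ‖inner ℂ u (act Y x)‖ ≤ ‖u‖ * ‖act Y x‖ := norm_inner_le_norm _ _
      _ ≤ _ := by rw [hu1, one_mul]; exact norm_act_le _ _
  · have h := hsub v
    rw [hu, wedge_smul_left, act_sub, sub_eq_iff_eq_add] at h
    have h' : act Y v = act (P * Y) v := by
      rw [h, show wedge (act Y v) (act Y v) = 0 by simp [wedge]; ring]
      simp
    have := norm_act_le (P * Y) v
    rwa [← h', hYv, hv, mul_one] at this
  · refine norm_le_of_act_le (by positivity) fun x => ?_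
    rw [hsub, norm_smul, norm_perp, hu1, mul_one, hu, wedge_smul_left, wedge_act, norm_mul,
      norm_mul, Complex.norm_real, norm_inv, norm_norm]
    have h := norm_wedge_le v x
    rw [hv, one_mul] at h
    calc ‖Y‖⁻¹ * (‖Y.det‖ * ‖wedge v x‖) ≤ ‖Y‖⁻¹ * (‖Y.det‖ * ‖x‖) := by gcongr
      _ = _ := by ring

/-- If `Y X x = a u` and `Y y = b u`, both sides of `key` equal `|a| |b| ‖Z u‖ ‖u‖`; the suprema
over `x` and `y` are then independent. -/
theorem norm_mul_mul_of_rank_one {Y : Mat2} {u : Vec2} (hY : ∀ x, ∃ z : ℂ, act Y x = z • u)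
    (Z X : Mat2) : ‖Z * Y * X‖ * ‖Y‖ = ‖Z * Y‖ * ‖Y * X‖ := by
  have key : ∀ x y, ‖act (Z * Y * X) x‖ * ‖act Y y‖ = ‖act (Z * Y) y‖ * ‖act (Y * X) x‖ := by
    intro x y
    obtain ⟨a, ha⟩ := hY (act X x)
    obtain ⟨b, hb⟩ := hY y
    simp only [act_mul, ha, hb, act_smul, norm_smul]
    ring
  have hunit : ∀ (A : Mat2) {v : Vec2}, ‖v‖ = 1 → ‖act A v‖ ≤ ‖A‖ := fun A v hv => by
    simpa [hv] using norm_act_le A v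
  apply le_antisymm
  · obtain ⟨x, hx, hx'⟩ := exists_norm_act_eq (Z * Y * X)
    obtain ⟨y, hy, hy'⟩ := exists_norm_act_eq Y
    rw [← hx', ← hy', key]
    exact mul_le_mul (hunit _ hy) (hunit _ hx) (norm_nonneg _) (norm_nonneg _)
  · obtain ⟨x, hx, hx'⟩ := exists_norm_act_eq (Y * X)
    obtain ⟨y, hy, hy'⟩ := exists_norm_act_eq (Z * Y)
    rw [← hx', ← hy', ← key]
    exact mul_le_mul (hunit _ hx) (hunit _ hy) (norm_nonneg _) (norm_nonneg _)

/-- The norm of a triple product whose middle factor is nearly of rank one. -/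
theorem abs_norm_triple_sub_le (Z Y X : Mat2) :
    |‖Z * Y * X‖ * ‖Y‖ - ‖Z * Y‖ * ‖Y * X‖| ≤ 3 * ‖Y.det‖ * ‖Z‖ * ‖X‖ := by
  rcases eq_or_ne Y 0 with rfl | hY
  · simp
  have hpos : 0 < ‖Y‖ := norm_pos_iff.mpr hY
  obtain ⟨Y₀, u, hnorm, herr, hrank⟩ := exists_rank_one_approx hY
  have hid := norm_mul_mul_of_rank_one hrank Z X
  rw [hnorm] at hid
  set e := ‖Y.det‖ / ‖Y‖ with he
  have hdet : ‖Y.det‖ = e * ‖Y‖ := by rw [he]; field_simp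
  have hZY : |‖Z * Y‖ - ‖Z * Y₀‖| ≤ ‖Z‖ * e := by
    refine (abs_norm_sub_norm_le _ _).trans ?_
    rw [← mul_sub]
    exact (norm_mul_le _ _).trans (by gcongr)
  have hYX : |‖Y * X‖ - ‖Y₀ * X‖| ≤ e * ‖X‖ := by
    refine (abs_norm_sub_norm_le _ _).trans ?_
    rw [← sub_mul]
    exact (norm_mul_le _ _).trans (by gcongr)
  have hZYX : |‖Z * Y * X‖ - ‖Z * Y₀ * X‖| ≤ ‖Z‖ * e * ‖X‖ := by
    refine (abs_norm_sub_norm_le _ _).trans ?_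
    rw [← sub_mul, ← mul_sub]
    refine (norm_mul_le _ _).trans ?_
    gcongr
    exact (norm_mul_le _ _).trans (by gcongr)
  -- The rank-one identity for `Y₀` cancels, leaving three differences, each at most `e ‖Y‖ ‖Z‖ ‖X‖
  -- = |det Y| ‖Z‖ ‖X‖`.
  have hid' : ‖Z * Y * X‖ * ‖Y‖ - ‖Z * Y‖ * ‖Y * X‖
      = (‖Z * Y * X‖ - ‖Z * Y₀ * X‖) * ‖Y‖
        + (-((‖Z * Y‖ - ‖Z * Y₀‖) * ‖Y * X‖) + -(‖Z * Y₀‖ * (‖Y * X‖ - ‖Y₀ * X‖))) := by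
    linear_combination hid
  rw [hid', hdet]
  refine (abs_add_le _ _).trans ?_
  refine (add_le_add le_rfl (abs_add_le _ _)).trans ?_
  rw [abs_neg, abs_neg, abs_mul, abs_mul, abs_mul, abs_of_pos hpos,
    abs_of_nonneg (norm_nonneg (Y * X)),
    abs_of_nonneg (norm_nonneg (Z * Y₀))]
  have h1 := mul_le_mul_of_nonneg_right hZYX hpos.le
  have h2 : |‖Z * Y‖ - ‖Z * Y₀‖| * ‖Y * X‖ ≤ ‖Z‖ * e * (‖Y‖ * ‖X‖) :=
    mul_le_mul hZY (norm_mul_le _ _) (norm_nonneg _) (by positivity)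
  have h3 : ‖Z * Y₀‖ * |‖Y * X‖ - ‖Y₀ * X‖| ≤ ‖Z‖ * ‖Y‖ * (e * ‖X‖) :=
    mul_le_mul (hnorm ▸ norm_mul_le _ _) hYX (abs_nonneg _) (by positivity)
  linarith

/-! ### Propagation of alignment to long products. -/

/-- Factors that are strongly projective, with consecutive factors well aligned. -/
structure IsAvalanche (B : ℤ → Mat2) (t : ℝ) : Prop where
  le_t : 256 ≤ t
  pos : ∀ j, 0 < ‖B j‖
  det_le : ∀ j, ‖(B j).det‖ * t ^ 4 ≤ ‖B j‖ ^ 2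
  pair_le : ∀ j, ‖B (j + 1)‖ * ‖B j‖ ≤ t * ‖B (j + 1) * B j‖

theorem abs_norm_triple_sub_le_of_aligned {t : ℝ} (ht : 0 < t) {Z Y X : Mat2}
    (hdet : ‖Y.det‖ * t ^ 4 ≤ ‖Y‖ ^ 2) (hZY : ‖Z‖ * ‖Y‖ ≤ 2 * t * ‖Z * Y‖)
    (hYX : ‖Y‖ * ‖X‖ ≤ 2 * t * ‖Y * X‖) :
    |‖Z * Y * X‖ * ‖Y‖ - ‖Z * Y‖ * ‖Y * X‖| ≤ 12 / t ^ 2 * (‖Z * Y‖ * ‖Y * X‖) := by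
  refine (abs_norm_triple_sub_le Z Y X).trans ?_
  have hd : ‖Y.det‖ ≤ ‖Y‖ ^ 2 / t ^ 4 := by rwa [le_div_iff₀ (by positivity)]
  calc 3 * ‖Y.det‖ * ‖Z‖ * ‖X‖ ≤ 3 * (‖Y‖ ^ 2 / t ^ 4) * ‖Z‖ * ‖X‖ := by gcongr
    _ = 3 / t ^ 4 * ((‖Z‖ * ‖Y‖) * (‖Y‖ * ‖X‖)) := by ring
    _ ≤ 3 / t ^ 4 * ((2 * t * ‖Z * Y‖) * (2 * t * ‖Y * X‖)) := by gcongr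
    _ = 12 / t ^ 2 * (‖Z * Y‖ * ‖Y * X‖) := by field_simp; ring

theorem half_le_norm_triple {t : ℝ} (ht : 256 ≤ t) {Z Y X : Mat2}
    (hdet : ‖Y.det‖ * t ^ 4 ≤ ‖Y‖ ^ 2) (hZY : ‖Z‖ * ‖Y‖ ≤ 2 * t * ‖Z * Y‖)
    (hYX : ‖Y‖ * ‖X‖ ≤ 2 * t * ‖Y * X‖) :
    ‖Z * Y‖ * ‖Y * X‖ ≤ 2 * (‖Z * Y * X‖ * ‖Y‖) := by
  have h := abs_le.mp (abs_norm_triple_sub_le_of_aligned (by linarith) hdet hZY hYX)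
  have h2 : 12 / t ^ 2 ≤ 1 / 2 := by
    rw [div_le_iff₀ (by positivity)]
    nlinarith
  have h3 := mul_le_mul_of_nonneg_right h2 (show 0 ≤ ‖Z * Y‖ * ‖Y * X‖ by positivity)
  linarith [h.1]

theorem iter_one (B : ℤ → Mat2) (j : ℤ) : iter B 1 j = B j := by simp [iter]

theorem iter_succ (B : ℤ → Mat2) (n : ℕ) (j : ℤ) :
    iter B (n + 1) j = B (j + n) * iter B n j := rfl

theorem iter_succ_right (B : ℤ → Mat2) (n : ℕ) (j : ℤ) :
    iter B (n + 1) j = iter B n (j + 1) * B j := by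
  induction n with
  | zero => simp [iter]
  | succ n ih =>
    rw [iter_succ, ih, iter_succ B n (j + 1), mul_assoc]
    congr 2
    push_cast
    ring

namespace IsAvalanche

variable {B : ℤ → Mat2} {t : ℝ}

theorem pair_le_two (h : IsAvalanche B t) (j : ℤ) :
    ‖B (j + 1)‖ * ‖B j‖ ≤ 2 * t * ‖B (j + 1) * B j‖ := by
  have := h.pair_le j
  have := h.le_t
  nlinarith [norm_nonneg (B (j + 1) * B j)]

/-- The constant does not deteriorate with `n`: in the triple estimate the new pair contributes its
original constant `t`, and the inductive bound serves only to make the error small, at the cost of a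
factor `2`. -/
theorem norm_mul_iter_le (h : IsAvalanche B t) (n : ℕ) (j : ℤ) :
    ‖B (j + (n + 1 : ℕ))‖ * ‖iter B (n + 1) j‖ ≤ 2 * t * ‖iter B (n + 2) j‖ := by
  have ht := h.le_t
  induction n with
  | zero => simpa [iter] using h.pair_le_two j
  | succ n ih =>
    have hidx : j + ((n + 1 + 1 : ℕ) : ℤ) = j + ((n + 1 : ℕ) : ℤ) + 1 := by push_cast; ring
    have hpair := h.pair_le (j + (n + 1 : ℕ))
    have hpair' := h.pair_le_two (j + (n + 1 : ℕ))
    have hY := h.pos (j + (n + 1 : ℕ))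
    have hdet := h.det_le (j + (n + 1 : ℕ))
    rw [iter_succ B (n + 2), iter_succ B (n + 1)] at *
    rw [hidx]
    have key := half_le_norm_triple ht hdet hpair' ih
    rw [← mul_assoc]
    refine le_of_mul_le_mul_right ?_ hY
    nlinarith [mul_le_mul_of_nonneg_right hpair
      (norm_nonneg (B (j + (n + 1 : ℕ)) * iter B (n + 1) j))]

theorem norm_iter_mul_le (h : IsAvalanche B t) (n : ℕ) (j : ℤ) :
    ‖iter B (n + 1) (j + 1)‖ * ‖B j‖ ≤ 2 * t * ‖iter B (n + 2) j‖ := by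
  have ht := h.le_t
  induction n generalizing j with
  | zero => simpa [iter] using h.pair_le_two j
  | succ n ih =>
    have hpair := h.pair_le j
    have hY := h.pos (j + 1)
    have ih := ih (j + 1)
    rw [iter_succ_right B (n + 2), iter_succ_right B (n + 1)] at *
    have key := half_le_norm_triple ht (h.det_le (j + 1)) ih (h.pair_le_two j)
    refine le_of_mul_le_mul_right ?_ hY
    nlinarith [mul_le_mul_of_nonneg_left hpair
      (norm_nonneg (iter B (n + 1) (j + 1 + 1) * B (j + 1)))]

theorem norm_iter_pos (h : IsAvalanche B t) (n : ℕ) (j : ℤ) : 0 < ‖iter B (n + 1) j‖ := by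
  have ht := h.le_t
  induction n with
  | zero => simpa [iter] using h.pos j
  | succ n ih =>
    have h1 := h.norm_mul_iter_le n j
    have h2 := mul_pos (h.pos (j + (n + 1 : ℕ))) ih
    exact pos_of_mul_pos_right (h2.trans_le h1) (by linarith)

/-- Past and future products are aligned. -/
theorem norm_iter_mul_norm_iter_le (h : IsAvalanche B t) (m n : ℕ) (i j : ℤ)
    (hij : i + (m + 1 : ℕ) = j) :
    ‖iter B (n + 2) j‖ * ‖iter B (m + 1) i‖ ≤ 4 * t * ‖iter B (n + 2) j * iter B (m + 1) i‖ := by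
  subst hij
  have ht := h.le_t
  have h1 := h.norm_mul_iter_le m i
  have h2 := h.norm_iter_mul_le n (i + (m + 1 : ℕ))
  have hY := h.pos (i + (m + 1 : ℕ))
  rw [iter_succ B (m + 1)] at h1
  rw [iter_succ_right B (n + 1)] at *
  -- The middle factor is the first one of the future, which is why the future product needs length
  -- at least two.
  have key := half_le_norm_triple ht (h.det_le _) h2 h1
  refine le_of_mul_le_mul_right ?_ hY
  nlinarith [mul_le_mul_of_nonneg_left h1
    (norm_nonneg (iter B (n + 1) (i + (m + 1 : ℕ) + 1) * B (i + (m + 1 : ℕ))))]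

/-- Each new factor multiplies `|det| / ‖·‖²` by at most `t⁻⁴ (2t)² = 4 / t² ≤ 1/2`. -/
theorem norm_det_iter_le (h : IsAvalanche B t) (n : ℕ) (j : ℤ) :
    ‖(iter B (n + 1) j).det‖ ≤ (1 / 2) ^ n * ‖iter B (n + 1) j‖ ^ 2 := by
  have ht := h.le_t
  have ht4 : 8 * t ^ 2 ≤ t ^ 4 := by
    rw [show t ^ 4 = t ^ 2 * t ^ 2 by ring]
    have : 8 ≤ t ^ 2 := by nlinarith
    gcongr
  have ht1 : (1 : ℝ) ≤ t ^ 4 := one_le_pow₀ (by linarith)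
  induction n with
  | zero =>
    rw [zero_add, iter_one]
    nlinarith [h.det_le j, norm_nonneg (B j).det]
  | succ n ih =>
    have h1 := h.norm_mul_iter_le n j
    have hd := h.det_le (j + (n + 1 : ℕ))
    have hsq : (‖B (j + (n + 1 : ℕ))‖ * ‖iter B (n + 1) j‖) ^ 2
        ≤ (2 * t * ‖iter B (n + 2) j‖) ^ 2 := by gcongr
    have hdet : ‖(iter B (n + 2) j).det‖
        = ‖(B (j + (n + 1 : ℕ))).det‖ * ‖(iter B (n + 1) j).det‖ := by
      rw [iter_succ B (n + 1), Matrix.det_mul, norm_mul]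
    refine le_of_mul_le_mul_right ?_ (show 0 < t ^ 4 by positivity)
    calc ‖(iter B (n + 2) j).det‖ * t ^ 4
        = (‖(B (j + (n + 1 : ℕ))).det‖ * t ^ 4) * ‖(iter B (n + 1) j).det‖ := by rw [hdet]; ring
      _ ≤ ‖B (j + (n + 1 : ℕ))‖ ^ 2 * ((1 / 2) ^ n * ‖iter B (n + 1) j‖ ^ 2) := by gcongr
      _ = (1 / 2) ^ n * (‖B (j + (n + 1 : ℕ))‖ * ‖iter B (n + 1) j‖) ^ 2 := by ring
      _ ≤ (1 / 2) ^ n * (2 * t * ‖iter B (n + 2) j‖) ^ 2 := by gcongr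
      _ = (1 / 2) ^ (n + 1) * ‖iter B (n + 2) j‖ ^ 2 * (8 * t ^ 2) := by ring
      _ ≤ (1 / 2) ^ (n + 1) * ‖iter B (n + 2) j‖ ^ 2 * t ^ 4 := by gcongr

end IsAvalanche

/-! ### Logarithmic form of the product estimate. -/

theorem abs_log_le_two_mul {x e : ℝ} (he : e ≤ 1 / 2) (hx : |x - 1| ≤ e) :
    |Real.log x| ≤ 2 * e := by
  have h := abs_le.mp hx
  have hpos : 0 < x := by linarith
  refine abs_le.mpr ⟨?_, ?_⟩
  · have h1 := Real.one_sub_inv_le_log_of_pos hpos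
    have h2 : x⁻¹ ≤ 1 + 2 * e := by
      rw [inv_le_iff_one_le_mul₀ hpos]
      nlinarith
    linarith
  · linarith [Real.log_le_sub_one_of_pos hpos]

theorem abs_log_quotient_le {z x y w e : ℝ} (hz : 0 < z) (hx : 0 < x) (hy : 0 < y) (hw : 0 < w)
    (he : e ≤ 1 / 2) (h : |z * y - w * x| ≤ e * (w * x)) :
    |Real.log z - Real.log x + Real.log y - Real.log w| ≤ 2 * e := by
  have hlog : Real.log z - Real.log x + Real.log y - Real.log w
      = Real.log (z * y / (w * x)) := by
    rw [Real.log_div (by positivity) (by positivity), Real.log_mul hz.ne' hy.ne',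
      Real.log_mul hw.ne' hx.ne']
    ring
  rw [hlog]
  refine abs_log_le_two_mul he ?_
  have hwx : 0 < w * x := mul_pos hw hx
  rwa [div_sub_one hwx.ne', abs_div, abs_of_pos hwx, div_le_iff₀ hwx]

namespace IsAvalanche

variable {B : ℤ → Mat2} {t : ℝ}

theorem abs_log_step_le (h : IsAvalanche B t) (n : ℕ) (j : ℤ) :
    |Real.log ‖iter B (n + 3) j‖ - Real.log ‖iter B (n + 2) j‖
      + Real.log ‖B (j + (n + 1 : ℕ))‖
      - Real.log ‖B (j + (n + 1 : ℕ) + 1) * B (j + (n + 1 : ℕ))‖| ≤ 24 / t ^ 2 := by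
  have ht := h.le_t
  have ht0 : 0 < t := by linarith
  have hYX := h.norm_mul_iter_le n j
  have hX1 := h.norm_iter_pos (n + 1) j
  have hX2 := h.norm_iter_pos (n + 2) j
  have hY := h.pos (j + (n + 1 : ℕ))
  have hidx : j + ((n + 2 : ℕ) : ℤ) = j + ((n + 1 : ℕ) : ℤ) + 1 := by push_cast; ring
  have hZY := h.pair_le_two (j + (n + 1 : ℕ))
  have hZY0 : 0 < ‖B (j + (n + 1 : ℕ) + 1) * B (j + (n + 1 : ℕ))‖ :=
    pos_of_mul_pos_right ((mul_pos (h.pos _) hY).trans_le hZY) (by linarith)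
  have h3 : iter B (n + 3) j
      = B (j + (n + 1 : ℕ) + 1) * B (j + (n + 1 : ℕ)) * iter B (n + 1) j := by
    rw [iter_succ B (n + 2), hidx, iter_succ B (n + 1), mul_assoc]
  have key := abs_norm_triple_sub_le_of_aligned ht0 (h.det_le (j + (n + 1 : ℕ))) hZY
    (X := iter B (n + 1) j) hYX
  rw [← h3] at key
  change |_ - _ * ‖iter B (n + 2) j‖| ≤ _ * (_ * ‖iter B (n + 2) j‖) at key
  have h2 : 12 / t ^ 2 ≤ 1 / 2 := by
    rw [div_le_iff₀ (by positivity)]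
    nlinarith
  rw [show 24 / t ^ 2 = 2 * (12 / t ^ 2) by ring]
  exact abs_log_quotient_le hX2 hX1 hY hZY0 h2 key

/-- The left side vanishes for `n = 0`, where the product is a single pair; `abs_log_step_le` bounds
each increment. -/
theorem abs_log_iter_le (h : IsAvalanche B t) (n : ℕ) (j : ℤ) :
    |Real.log ‖iter B (n + 2) j‖ + ∑ k ∈ Finset.Icc 1 n, Real.log ‖B (j + (k : ℤ))‖
      - ∑ k ∈ Finset.range (n + 1), Real.log ‖B (j + (k : ℤ) + 1) * B (j + (k : ℤ))‖|
      ≤ n * (24 / t ^ 2) := by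
  induction n with
  | zero => simp [iter]
  | succ n ih =>
    have hstep := h.abs_log_step_le n j
    rw [Finset.sum_range_succ, Finset.sum_Icc_succ_top (by omega)]
    have := abs_le.mp ih
    have := abs_le.mp hstep
    push_cast at *
    refine abs_le.mpr ⟨?_, ?_⟩ <;> linarith

end IsAvalanche

/-! ### Limits of normalized products. -/

open Filter Topology

/-- The matrix of norm one proportional to `A`. -/
def unitize (A : Mat2) : Mat2 := ((‖A‖⁻¹ : ℝ) : ℂ) • A

theorem norm_unitize_le (A : Mat2) : ‖unitize A‖ ≤ 1 := by
  rw [unitize, norm_smul, Complex.norm_real, norm_inv, norm_norm]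
  exact inv_mul_le_one

theorem norm_det_unitize (A : Mat2) : ‖(unitize A).det‖ = ‖A.det‖ / ‖A‖ ^ 2 := by
  rw [unitize, Matrix.det_smul, norm_mul, norm_pow, Complex.norm_real, norm_inv, norm_norm]
  simp only [Fintype.card_fin]
  ring

theorem le_norm_mul_unitize {A G : Mat2} {K : ℝ} (hG : 0 < ‖G‖)
    (h : ‖A‖ * ‖G‖ ≤ K * ‖A * G‖) : ‖A‖ ≤ K * ‖A * unitize G‖ := by
  rw [unitize, mul_smul_comm, norm_smul, Complex.norm_real, norm_inv, norm_norm]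
  refine le_of_mul_le_mul_right (h.trans_eq ?_) hG
  field_simp

theorem le_norm_unitize_mul_unitize {A G : Mat2} {K : ℝ} (hA : 0 < ‖A‖) (hG : 0 < ‖G‖)
    (h : ‖A‖ * ‖G‖ ≤ K * ‖A * G‖) : 1 ≤ K * ‖unitize A * unitize G‖ := by
  have h1 := le_norm_mul_unitize hG h
  rw [unitize, smul_mul_assoc, norm_smul, Complex.norm_real, norm_inv, norm_norm]
  refine le_of_mul_le_mul_right (?_ : _ ≤ _) hA
  rw [one_mul]
  refine h1.trans_eq ?_
  field_simp

theorem smul_unitize_mul (A G : Mat2) :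
    (‖A * unitize G‖ : ℂ) • unitize (A * G) = A * unitize G := by
  rcases eq_or_ne (A * G) 0 with h | h
  · simp [unitize, h]
  have h' : (‖A * G‖ : ℂ) ≠ 0 := by simpa using h
  simp only [unitize, mul_smul_comm, norm_smul, smul_smul, Complex.norm_real, norm_inv, norm_norm]
  congr 1
  push_cast
  field_simp

theorem smul_unitize_mul' (G A : Mat2) :
    (‖unitize G * A‖ : ℂ) • unitize (G * A) = unitize G * A := by
  rcases eq_or_ne (G * A) 0 with h | h
  · simp [unitize, h]
  have h' : (‖G * A‖ : ℂ) ≠ 0 := by simpa using h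
  simp only [unitize, smul_mul_assoc, norm_smul, smul_smul, Complex.norm_real, norm_inv, norm_norm]
  congr 1
  push_cast
  field_simp

/-- One ultrafilter serves all `j` and both families at once, so relations between neighbouring
indices pass to the limit without a diagonal subsequence. -/
theorem exists_tendsto_unitize (F : ℕ → Mat2) :
    ∃ U, ‖U‖ ≤ 1 ∧ Tendsto (fun k => unitize (F k)) (hyperfilter ℕ) (𝓝 U) := by
  have : ProperSpace Mat2 := FiniteDimensional.proper ℂ Mat2
  obtain ⟨U, hU, hlim⟩ := (isCompact_closedBall (0 : Mat2) 1).ultrafilter_le_nhds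
    ((hyperfilter ℕ).map fun k => unitize (F k)) (by
      rw [le_principal_iff, Ultrafilter.coe_map, mem_map]
      exact univ_mem' fun k => by simpa using norm_unitize_le (F k))
  exact ⟨U, by simpa using hU, hlim⟩

/-- The product of the factors from `-k` up to `j - 1`. -/
def past (B : ℤ → Mat2) (k : ℕ) (j : ℤ) : Mat2 := iter B (j + k).toNat (-k)

/-- The product of the factors from `j` up to `k - 1`. -/
def future (B : ℤ → Mat2) (k : ℕ) (j : ℤ) : Mat2 := iter B (k - j).toNat j

/-- For large `k` the truncation in `toNat` is harmless and the product has more than `b` factors.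
-/
theorem exists_past_eq (B : ℤ → Mat2) {k : ℕ} {j : ℤ} {b : ℕ} (h : j.natAbs + b + 2 ≤ k) :
    ∃ n : ℕ, b ≤ n ∧ -(k : ℤ) + (n + 1 : ℕ) = j ∧ past B k j = iter B (n + 1) (-k) := by
  refine ⟨(j + k).toNat - 1, by omega, by omega, ?_⟩
  rw [past]
  congr 1
  omega

theorem exists_future_eq (B : ℤ → Mat2) {k : ℕ} {j : ℤ} {b : ℕ} (h : j.natAbs + b + 2 ≤ k) :
    ∃ n : ℕ, b ≤ n ∧ future B k j = iter B (n + 2) j := by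
  refine ⟨(k - j).toNat - 2, by omega, ?_⟩
  rw [future]
  congr 1
  omega

theorem past_succ (B : ℤ → Mat2) {k : ℕ} {j : ℤ} (h : j.natAbs + 2 ≤ k) :
    past B k (j + 1) = B j * past B k j := by
  rw [past, past, show (j + 1 + k).toNat = (j + k).toNat + 1 by omega, iter_succ]
  congr 2
  omega

theorem future_eq_mul (B : ℤ → Mat2) {k : ℕ} {j : ℤ} (h : j.natAbs + 2 ≤ k) :
    future B k j = future B k (j + 1) * B j := by
  rw [future, future, show (k - j).toNat = (k - (j + 1)).toNat + 1 by omega, iter_succ_right]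

theorem eventually_hyperfilter_ge (b : ℕ) : ∀ᶠ k in (hyperfilter ℕ : Filter ℕ), b ≤ k :=
  Nat.hyperfilter_le_atTop (eventually_ge_atTop b)

theorem det_eq_zero_of_tendsto {F : ℕ → Mat2} {U : Mat2}
    (hU : Tendsto (fun k => unitize (F k)) (hyperfilter ℕ) (𝓝 U))
    (hF : ∀ b : ℕ, ∀ᶠ k in (hyperfilter ℕ : Filter ℕ),
      ‖(F k).det‖ ≤ (1 / 2) ^ b * ‖F k‖ ^ 2) : U.det = 0 := by
  have hlim : Tendsto (fun k => ‖(unitize (F k)).det‖) (hyperfilter ℕ) (𝓝 ‖U.det‖) :=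
    ((continuous_id.matrix_det.tendsto U).comp hU).norm
  have hle : ∀ b : ℕ, ‖U.det‖ ≤ (1 / 2) ^ b := fun b => by
    refine le_of_tendsto hlim ?_
    filter_upwards [hF b] with k hk
    rw [norm_det_unitize]
    exact div_le_of_le_mul₀ (by positivity) (by positivity) hk
  have h0 : ‖U.det‖ ≤ 0 :=
    ge_of_tendsto' (tendsto_pow_atTop_nhds_zero_of_lt_one (by norm_num) (by norm_num)) hle
  exact norm_le_zero_iff.mp h0

/-- Limits of normalized past and future products. -/
theorem IsAvalanche.exists_limits {B : ℤ → Mat2} {t : ℝ} (h : IsAvalanche B t) :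
    ∃ U S : ℤ → Mat2,
      (∀ j, ‖U j‖ ≤ 1) ∧ (∀ j, ‖S j‖ ≤ 1) ∧ (∀ j, (U j).det = 0) ∧ (∀ j, (S j).det = 0) ∧
      (∀ j, 1 ≤ 4 * t * ‖S j * U j‖) ∧ (∀ j, ‖B j‖ ≤ 2 * t * ‖B j * U j‖) ∧
      (∀ j, ∃ z : ℂ, B j * U j = z • U (j + 1)) ∧
      (∀ j, ∃ z : ℂ, S (j + 1) * B j = z • S j) := by
  choose U hU1 hU using fun j => exists_tendsto_unitize fun k => past B k j
  choose S hS1 hS using fun j => exists_tendsto_unitize fun k => future B k j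
  have hcoe : Continuous fun x : ℝ => (x : ℂ) := Complex.continuous_ofReal
  refine ⟨U, S, hU1, hS1, fun j => ?_, fun j => ?_, fun j => ?_, fun j => ?_, fun j => ?_,
    fun j => ?_⟩
  · refine det_eq_zero_of_tendsto (hU j) fun b => ?_
    filter_upwards [eventually_hyperfilter_ge (j.natAbs + b + 2)] with k hk
    obtain ⟨n, hbn, -, hn⟩ := exists_past_eq B hk
    rw [hn]
    refine (h.norm_det_iter_le n _).trans ?_
    gcongr ?_ * _
    exact pow_le_pow_of_le_one (by norm_num) (by norm_num) hbn
  · refine det_eq_zero_of_tendsto (hS j) fun b => ?_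
    filter_upwards [eventually_hyperfilter_ge (j.natAbs + b + 2)] with k hk
    obtain ⟨n, hbn, hn⟩ := exists_future_eq B hk
    rw [hn]
    refine (h.norm_det_iter_le (n + 1) _).trans ?_
    gcongr ?_ * _
    exact pow_le_pow_of_le_one (by norm_num) (by norm_num) (by omega)
  · refine ge_of_tendsto (((hS j).mul (hU j)).norm.const_mul (4 * t)) ?_
    filter_upwards [eventually_hyperfilter_ge (j.natAbs + 0 + 2)] with k hk
    obtain ⟨m, -, hm, hpast⟩ := exists_past_eq B (j := j) (b := 0) hk
    obtain ⟨n, -, hfut⟩ := exists_future_eq B (j := j) (b := 0) hk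
    rw [hpast, hfut]
    exact le_norm_unitize_mul_unitize (h.norm_iter_pos _ _) (h.norm_iter_pos _ _)
      (h.norm_iter_mul_norm_iter_le m n _ j hm)
  · refine ge_of_tendsto ((tendsto_const_nhds.mul (hU j)).norm.const_mul (2 * t)) ?_
    filter_upwards [eventually_hyperfilter_ge (j.natAbs + 0 + 2)] with k hk
    obtain ⟨m, -, hm, hpast⟩ := exists_past_eq B (j := j) (b := 0) hk
    rw [hpast]
    refine le_norm_mul_unitize (h.norm_iter_pos _ _) ?_
    have := h.norm_mul_iter_le m (-k)
    rwa [iter_succ B (m + 1), hm] at this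
  · have hlim : Tendsto (fun k => B j * unitize (past B k j)) (hyperfilter ℕ) (𝓝 (B j * U j)) :=
      tendsto_const_nhds.mul (hU j)
    refine ⟨(‖B j * U j‖ : ℂ), tendsto_nhds_unique hlim ?_⟩
    refine (((hcoe.tendsto _).comp hlim.norm).smul (hU (j + 1))).congr' ?_
    filter_upwards [eventually_hyperfilter_ge (j.natAbs + 2)] with k hk
    rw [past_succ B hk]
    exact smul_unitize_mul _ _
  · have hlim : Tendsto (fun k => unitize (future B k (j + 1)) * B j) (hyperfilter ℕ)
        (𝓝 (S (j + 1) * B j)) := (hS (j + 1)).mul tendsto_const_nhds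
    refine ⟨(‖S (j + 1) * B j‖ : ℂ), tendsto_nhds_unique hlim ?_⟩
    refine (((hcoe.tendsto _).comp hlim.norm).smul (hS j)).congr' ?_
    filter_upwards [eventually_hyperfilter_ge (j.natAbs + 2)] with k hk
    rw [future_eq_mul B hk]
    exact smul_unitize_mul' _ _

/-! ### Lines defined by singular matrices. -/

/-- As `U` is singular, `U x` is parallel to `u` for every `x`. Taking `x` maximizing for `A * U`
gives `‖A U‖ ‖u‖ = ‖U x‖ ‖A u‖ ≤ ‖A u‖`. -/
theorem norm_le_norm_act_of_mem_range {U A : Mat2} {K L : ℝ} (hdet : U.det = 0) (hU : ‖U‖ ≤ 1)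
    (hK : 0 ≤ K) (h : L ≤ K * ‖A * U‖) {u : Vec2}
    (hu : u ∈ LinearMap.range (Matrix.toEuclideanLin U)) : L * ‖u‖ ≤ K * ‖act A u‖ := by
  rcases eq_or_ne u 0 with rfl | hu0
  · simp; positivity
  have hpos : 0 < ‖u‖ := norm_pos_iff.mpr hu0
  obtain ⟨y, hy⟩ := hu
  change act U y = u at hy
  obtain ⟨x, hx, hAx⟩ := exists_norm_act_eq (A * U)
  have hw : wedge u (act U x) = 0 := by rw [← hy, wedge_act, hdet, zero_mul]
  have hpar := norm_sq_smul_eq u (act U x)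
  rw [hw, zero_smul, add_zero] at hpar
  have h1 : ‖u‖ ^ 2 * ‖act U x‖ = ‖inner ℂ u (act U x)‖ * ‖u‖ := by
    have := congrArg norm hpar
    rwa [norm_smul, norm_smul, Complex.norm_real, Real.norm_of_nonneg (by positivity)] at this
  have h2 : ‖u‖ ^ 2 * ‖A * U‖ = ‖inner ℂ u (act U x)‖ * ‖act A u‖ := by
    have := congrArg (fun v => ‖act A v‖) hpar
    simp only [act_smul, norm_smul, Complex.norm_real] at this
    rwa [Real.norm_of_nonneg (by positivity), ← act_mul, hAx] at this
  have h3 : ‖act U x‖ ≤ 1 := by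
    have := norm_act_le U x
    rw [hx, mul_one] at this
    exact this.trans hU
  have h4 : ‖A * U‖ * ‖u‖ ≤ ‖act A u‖ := by
    refine le_of_mul_le_mul_left ?_ (show 0 < ‖u‖ ^ 2 by positivity)
    calc ‖u‖ ^ 2 * (‖A * U‖ * ‖u‖) = ‖inner ℂ u (act U x)‖ * ‖u‖ * ‖act A u‖ := by
          rw [← mul_assoc, h2]; ring
      _ = ‖u‖ ^ 2 * (‖act U x‖ * ‖act A u‖) := by rw [← h1]; ring
      _ ≤ ‖u‖ ^ 2 * (1 * ‖act A u‖) := by gcongr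
      _ = ‖u‖ ^ 2 * ‖act A u‖ := by ring
  calc L * ‖u‖ ≤ K * ‖A * U‖ * ‖u‖ := by gcongr
    _ = K * (‖A * U‖ * ‖u‖) := by ring
    _ ≤ K * ‖act A u‖ := by gcongr

/-- Only the component of `u` along `perp s` survives `S`, and its coefficient is the wedge. -/
theorem norm_mul_norm_act_le_of_mem_ker {S : Mat2} {s : Vec2} (hs : act S s = 0) (u : Vec2) :
    ‖s‖ * ‖act S u‖ ≤ ‖S‖ * ‖wedge s u‖ := by
  rcases eq_or_ne s 0 with rfl | hs0
  · simp; positivity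
  have hpos : 0 < ‖s‖ := norm_pos_iff.mpr hs0
  have h := congrArg (fun v => ‖act S v‖) (norm_sq_smul_eq s u)
  simp only [act_add, act_smul, hs, smul_zero, zero_add, norm_smul, Complex.norm_real] at h
  rw [Real.norm_of_nonneg (by positivity)] at h
  have h2 := norm_act_le S (perp s)
  rw [norm_perp] at h2
  refine le_of_mul_le_mul_left ?_ hpos
  calc ‖s‖ * (‖s‖ * ‖act S u‖) = ‖wedge s u‖ * ‖act S (perp s)‖ := by rw [← h]; ring
    _ ≤ ‖wedge s u‖ * (‖S‖ * ‖s‖) := by gcongr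
    _ = _ := by ring

theorem finrank_range_ker_eq_one {A : Mat2} (hdet : A.det = 0) (hA : A ≠ 0) :
    Module.finrank ℂ (LinearMap.range (Matrix.toEuclideanLin A)) = 1 ∧
      Module.finrank ℂ (LinearMap.ker (Matrix.toEuclideanLin A)) = 1 := by
  have hsum := LinearMap.finrank_range_add_finrank_ker (Matrix.toEuclideanLin A)
  rw [finrank_euclideanSpace_fin] at hsum
  have hr : Module.finrank ℂ (LinearMap.range (Matrix.toEuclideanLin A)) ≠ 0 := by
    rw [Ne, Submodule.finrank_eq_zero, LinearMap.range_eq_bot]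
    simpa using hA
  have hk : Module.finrank ℂ (LinearMap.ker (Matrix.toEuclideanLin A)) ≠ 0 := by
    obtain ⟨v, hv, hAv⟩ := Matrix.exists_mulVec_eq_zero_iff.mpr hdet
    rw [Ne, Submodule.finrank_eq_zero]
    intro hbot
    refine hv ?_
    have : WithLp.toLp 2 v ∈ LinearMap.ker (Matrix.toEuclideanLin A) := by
      simp [Matrix.toLpLin_apply, hAv]
    rw [hbot, Submodule.mem_bot] at this
    simpa using this
  omega

/-! ### Chordal distance of unit vectors. -/

theorem sqrt_one_add_norm_div_sq {v : Vec2} (hv : ‖v‖ = 1) (h0 : v 0 ≠ 0) :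
    √(1 + ‖v 1 / v 0‖ ^ 2) = ‖v 0‖⁻¹ := by
  have hp : 0 < ‖v 0‖ := norm_pos_iff.mpr h0
  have h := norm_sq_eq_sum v
  rw [hv] at h
  rw [Real.sqrt_eq_iff_mul_self_eq (by positivity) (by positivity), norm_div]
  field_simp
  linarith

theorem norm_apply_one_eq_one {v : Vec2} (hv : ‖v‖ = 1) (h0 : v 0 = 0) : ‖v 1‖ = 1 := by
  have h := norm_sq_eq_sum v
  rw [hv, h0] at h
  refine (sq_eq_sq₀ (norm_nonneg _) zero_le_one).mp ?_
  simpa using h.symm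

/-- The chordal distance of two unit vectors. -/
theorem chordalDist_proj {u s : Vec2} (hu : ‖u‖ = 1) (hs : ‖s‖ = 1) :
    chordalDist (proj u) (proj s) = 2 * ‖wedge s u‖ := by
  by_cases hu0 : u 0 = 0 <;> by_cases hs0 : s 0 = 0
  · rw [proj, proj, if_pos hu0, if_pos hs0]
    change (0 : ℝ) = _
    simp [wedge, hu0, hs0]
  · rw [proj, proj, if_pos hu0, if_neg hs0]
    change 2 / √(1 + ‖s 1 / s 0‖ ^ 2) = _
    rw [sqrt_one_add_norm_div_sq hs hs0]
    simp [wedge, hu0, norm_apply_one_eq_one hu hu0]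
  · rw [proj, proj, if_neg hu0, if_pos hs0]
    change 2 / √(1 + ‖u 1 / u 0‖ ^ 2) = _
    rw [sqrt_one_add_norm_div_sq hu hu0]
    simp [wedge, hs0, norm_apply_one_eq_one hs hs0]
  · rw [proj, proj, if_neg hu0, if_neg hs0]
    change 2 * ‖u 1 / u 0 - s 1 / s 0‖ / √((1 + ‖u 1 / u 0‖ ^ 2) * (1 + ‖s 1 / s 0‖ ^ 2)) = _
    rw [Real.sqrt_mul (by positivity), sqrt_one_add_norm_div_sq hu hu0,
      sqrt_one_add_norm_div_sq hs hs0, div_sub_div _ _ hu0 hs0, norm_div, norm_mul]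
    have h1 : ‖u 0‖ ≠ 0 := norm_ne_zero_iff.mpr hu0
    have h2 : ‖s 0‖ ≠ 0 := norm_ne_zero_iff.mpr hs0
    field_simp
    rw [wedge, mul_comm (u 1), mul_comm (u 0)]

/-! ### Dominated splitting and conclusion. -/

theorem IsAvalanche.hasDominatedSplitting {B : ℤ → Mat2} {t c : ℝ} (h : IsAvalanche B t)
    (hc : 0 < c) (hB : ∀ j, c < ‖B j‖) : HasDominatedSplitting B := by
  have ht := h.le_t
  have ht0 : 0 < t := by linarith
  obtain ⟨U, S, hU1, hS1, hUdet, hSdet, hSU, hBU, hBUz, hSBz⟩ := h.exists_limits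
  have hne : ∀ j, S j * U j ≠ 0 := fun j h0 => by
    have := hSU j
    rw [h0, norm_zero] at this
    linarith
  let Eu : ℤ → Submodule ℂ Vec2 := fun j => LinearMap.range (Matrix.toEuclideanLin (U j))
  let Es : ℤ → Submodule ℂ Vec2 := fun j => LinearMap.ker (Matrix.toEuclideanLin (S j))
  have hEu : ∀ j, ∀ v ∈ Eu j, act (B j) v ∈ Eu (j + 1) := by
    rintro j v ⟨x, rfl⟩
    obtain ⟨z, hz⟩ := hBUz j
    refine ⟨z • x, ?_⟩
    change act (U (j + 1)) (z • x) = act (B j) (act (U j) x)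
    rw [← act_mul, hz, act_smul]
    simp [act]
  have hEs : ∀ j, ∀ v ∈ Es j, act (B j) v ∈ Es (j + 1) := by
    intro j v hv
    obtain ⟨z, hz⟩ := hSBz j
    change act (S (j + 1)) (act (B j) v) = 0
    have hv' : act (S j) v = 0 := hv
    rw [← act_mul, hz]
    have : act (z • S j) v = z • act (S j) v := by simp [act]
    rw [this, hv', smul_zero]
  have hangle : ∀ j, ∀ u ∈ Eu j, ∀ s ∈ Es j, ‖u‖ * ‖s‖ ≤ 4 * t * ‖wedge s u‖ := by
    intro j u hu s hs
    have h1 := norm_le_norm_act_of_mem_range (hUdet j) (hU1 j) (by positivity) (hSU j) hu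
    have h2 := norm_mul_norm_act_le_of_mem_ker (show act (S j) s = 0 from hs) u
    calc ‖u‖ * ‖s‖ = ‖s‖ * (1 * ‖u‖) := by ring
      _ ≤ ‖s‖ * (4 * t * ‖act (S j) u‖) := by gcongr
      _ = 4 * t * (‖s‖ * ‖act (S j) u‖) := by ring
      _ ≤ 4 * t * (‖S j‖ * ‖wedge s u‖) := by gcongr
      _ ≤ 4 * t * (1 * ‖wedge s u‖) := by gcongr; exact hS1 j
      _ = _ := by ring
  refine ⟨Eu, Es, fun j => ?_, fun j => ?_, hEu, hEs, ⟨1, le_rfl, ⟨2, one_lt_two, ?_⟩, ?_⟩, ?_⟩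
  · exact (finrank_range_ker_eq_one (hUdet j) (right_ne_zero_of_mul (hne j))).1
  · exact (finrank_range_ker_eq_one (hSdet j) (left_ne_zero_of_mul (hne j))).2
  · intro j u hu s hs hu1 hs1
    rw [iter_one]
    have h1 := norm_le_norm_act_of_mem_range (hUdet j) (hU1 j) (by positivity) (hBU j) hu
    rw [hu1, mul_one] at h1
    have h2 := hangle (j + 1) _ (hEu j u hu) _ (hEs j s hs)
    rw [wedge_act, norm_mul] at h2
    have h3 := norm_wedge_le s u
    rw [hu1, hs1, one_mul] at h3
    have hBu : 0 < ‖act (B j) u‖ := pos_of_mul_pos_right ((h.pos j).trans_le h1) (by linarith)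
    -- The angle bound at `j + 1` gives `‖Bu‖ ‖Bs‖ ≤ 4t |det B| ≤ 4t⁻³ ‖B‖²`, and `‖B‖ ≤ 2t ‖Bu‖`.
    -- With `t ≥ 256` the ratio `‖Bs‖ / ‖Bu‖` is at most `1/16`, so `λ = 2` has room to spare.
    have h4 : ‖act (B j) s‖ * t ≤ 16 * ‖act (B j) u‖ := by
      refine le_of_mul_le_mul_left ?_ (show 0 < ‖act (B j) u‖ * t ^ 3 by positivity)
      calc ‖act (B j) u‖ * t ^ 3 * (‖act (B j) s‖ * t)
          = (‖act (B j) u‖ * ‖act (B j) s‖) * t ^ 4 := by ring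
        _ ≤ (4 * t * (‖(B j).det‖ * ‖wedge s u‖)) * t ^ 4 := by gcongr
        _ ≤ (4 * t * (‖(B j).det‖ * 1)) * t ^ 4 := by gcongr
        _ = 4 * t * (‖(B j).det‖ * t ^ 4) := by ring
        _ ≤ 4 * t * ‖B j‖ ^ 2 := mul_le_mul_of_nonneg_left (h.det_le j) (by positivity)
        _ ≤ 4 * t * (2 * t * ‖act (B j) u‖) ^ 2 := by gcongr
        _ = ‖act (B j) u‖ * t ^ 3 * (16 * ‖act (B j) u‖) := by ring
    nlinarith [norm_nonneg (act (B j) s)]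
  · exact ⟨c, hc, fun j => by rw [iter_one]; exact (hB j).le⟩
  · refine ⟨1 / (2 * t), by positivity, fun j u hu s hs hu1 hs1 => ?_⟩
    have h1 := hangle j u hu s hs
    rw [hu1, hs1, one_mul] at h1
    rw [chordalDist_proj hu1 hs1, div_le_iff₀ (by positivity)]
    linarith

/-- The hypotheses on singular values, with `μ = t ^ 4`. -/
theorem isAvalanche_of_sigma {B : ℤ → Mat2} {t : ℝ} (ht : 256 ≤ t) (hpos : ∀ j, 0 < ‖B j‖)
    (hsigma : ∀ j, sigma2 (B j) / sigma1 (B j) ≤ (t ^ 4)⁻¹) (hne : ∀ j, B (j + 1) * B j ≠ 0)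
    (hpair : ∀ j, sigma1 (B (j + 1)) * sigma1 (B j) / sigma1 (B (j + 1) * B j) ≤ t) :
    IsAvalanche B t := by
  refine ⟨ht, hpos, fun j => ?_, fun j => ?_⟩
  · have h := hsigma j
    have hp := hpos j
    rw [sigma1, sigma2, div_div, ← one_div, div_le_div_iff₀ (by positivity) (by positivity)] at h
    linarith
  · have h := hpair j
    rwa [sigma1, sigma1, sigma1, div_le_iff₀ (norm_pos_iff.mpr (hne j))] at h

end DomSplit

end

theorem theorem2 :
    ∃ C μ₀ : ℝ, 0 < C ∧ 1 < μ₀ ∧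
      ∀ (c M μ : ℝ) (B : ℤ → DomSplit.Mat2),
        0 < c →
        (∀ j, c < ‖B j‖ ∧ ‖B j‖ < M) →
        μ₀ ≤ μ →
        (∀ j, DomSplit.sigma2 (B j) / DomSplit.sigma1 (B j) ≤ μ⁻¹) →
        (∀ j, B (j + 1) * B j ≠ 0) →
        (∀ j, DomSplit.sigma1 (B (j + 1)) * DomSplit.sigma1 (B j) /
          DomSplit.sigma1 (B (j + 1) * B j) ≤ μ ^ (1 / 4 : ℝ)) →
        DomSplit.HasDominatedSplitting B ∧
        ∀ (j : ℤ) (n : ℕ), 3 ≤ n →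
          DomSplit.iter B n j ≠ 0 ∧
          |Real.log ‖DomSplit.iter B n j‖
              + ∑ k ∈ Finset.Icc 1 (n - 2), Real.log ‖B (j + (k : ℤ))‖
              - ∑ k ∈ Finset.range (n - 1), Real.log ‖B (j + (k : ℤ) + 1) * B (j + (k : ℤ))‖|
            ≤ C * (n : ℝ) * μ ^ (-(1 / 2) : ℝ) := by
  -- `μ₀ = 256 ^ 4` makes `t ≥ 256`; `24` is twice the relative error constant `12`, the doubling
  -- coming from the logarithm.
  refine ⟨24, 256 ^ 4, by norm_num, by norm_num, ?_⟩
  intro c M μ B hc hB hμ hsigma hne hpair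
  have hμ0 : 0 ≤ μ := le_trans (by norm_num) hμ
  set t := μ ^ (1 / 4 : ℝ) with ht
  have ht4 : t ^ 4 = μ := by
    rw [ht, ← Real.rpow_mul_natCast hμ0]
    norm_num
  have ht0 : 0 ≤ t := Real.rpow_nonneg hμ0 _
  have ht256 : 256 ≤ t := by
    rw [← ht4] at hμ
    exact (pow_le_pow_iff_left₀ (by norm_num) ht0 (by norm_num)).mp hμ
  have hrate : μ ^ (-(1 / 2) : ℝ) = 1 / t ^ 2 := by
    rw [Real.rpow_neg hμ0, ht, ← Real.rpow_mul_natCast hμ0]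
    norm_num
  rw [← ht4] at hsigma
  have h := DomSplit.isAvalanche_of_sigma ht256 (fun j => hc.trans (hB j).1) hsigma hne hpair
  refine ⟨h.hasDominatedSplitting hc fun j => (hB j).1, fun j n hn => ?_⟩
  obtain ⟨m, rfl⟩ : ∃ m, n = m + 2 := ⟨n - 2, by omega⟩
  refine ⟨norm_pos_iff.mp (h.norm_iter_pos (m + 1) j), (h.abs_log_iter_le m j).trans ?_⟩
  rw [hrate, show 24 * ((m + 2 : ℕ) : ℝ) * (1 / t ^ 2) = ((m + 2 : ℕ) : ℝ) * (24 / t ^ 2) by ring]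
  gcongr
  omega
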